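/- Define the flattening of a binary word $w=b_1b_2\cdots b_n\in\{0,1\}^*$ to be the word $\mathrm{fl}(w)=\mathrm{fl}(b_1)\,\mathrm{fl}(b_2)\cdots \mathrm{fl}(b_n)\in\{0,1\}^*$ of length $2n$, where $\mathrm{fl}(0)=10$ and $\mathrm{fl}(1)=01$. For a decision problem $L\subseteq\{0,1\}^*$, the flattened problem of $L$ is $\mathrm{fl}(L)=\{\mathrm{fl}(w) : w\in L\}\subseteq\{0,1\}^*$. (1) The function $w\mapsto \mathrm{fl}(w)$ is computed by a deterministic logarithmic-space Turing machine, i.e. by a deterministic Turing machine with a read-only input tape, a write-only output tape and a read/write work tape, which halts on every input and visits only $O(\log n)$ cells of the work tape on inputs of length $n$. (2) Consequently, for every $L\subseteq\{0,1\}^*$ that is P-complete under logarithmic-space many-one reductions, the flattened problem $\mathrm{fl}(L)$ is also P-complete under logarithmic-space many-one reductions. -/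

import Mathlib

namespace LogSpaceFlattening

/-- A head movement. -/
inductive Move : Type
  | left
  | stay
  | right

/-- What the head on the read-only input tape can see: an input bit, or one of the two end markers
surrounding the input word. -/
inductive InputSymbol : Type
  | leftEnd
  | bit (b : Bool)
  | rightEnd

/-- What a machine does in one step: the next state, the move of the input head, the symbol written
on the work tape, the move of the work head, and at most one bit appended to the output. -/
structure Action (State Sym : Type) : Type where
  next : State
  inputMove : Move
  write : Sym
  workMove : Move
  output : Option Bool

/-- A deterministic Turing machine over the input and output alphabet `{0, 1}` (`false` is `0`,
`true` is `1`), with a two-way read-only input tape, one read/write work tape (one-way infinite),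
and a one-way write-only output tape. The machine halts where `trans` is `none`. -/
structure DTM : Type 1 where
  State : Type
  Sym : Type
  finite_state : Finite State
  finite_sym : Finite Sym
  start : State
  blank : Sym
  accept : Set State
  trans : State → InputSymbol → Sym → Option (Action State Sym)

namespace DTM

/-- A configuration. Input cell `0` holds the left end marker, cells `1, …, n` the input bits,
cell `n + 1` the right end marker. Work cells are numbered `0, 1, 2, …`. -/
structure Cfg (M : DTM) : Type where
  state : M.State
  inputPos : ℕ
  work : ℕ → M.Sym
  workPos : ℕ
  output : List Bool

/-- The content of cell `i` of the input tape on input `w`. -/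
def readInput (w : List Bool) : ℕ → InputSymbol
  | 0 => .leftEnd
  | i + 1 =>
    match w[i]? with
    | some b => .bit b
    | none => .rightEnd

/-- The input head cannot leave the cells `0, …, n + 1`, where `n` is the input length: a move
beyond an end marker leaves it in place. -/
def moveInput (n : ℕ) : Move → ℕ → ℕ
  | .left, i => i - 1
  | .stay, i => i
  | .right, i => min (i + 1) (n + 1)

/-- The work head stays in place when it is told to move left from cell `0`. -/
def moveWork : Move → ℕ → ℕ
  | .left, i => i - 1
  | .stay, i => i
  | .right, i => i + 1

variable (M : DTM)

/-- The initial configuration: blank work tape, empty output, both heads on cell `0`. -/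
def init : M.Cfg where
  state := M.start
  inputPos := 0
  work := fun _ => M.blank
  workPos := 0
  output := []

/-- One step of the machine on input `w`; `none` if the machine has halted. -/
def step (w : List Bool) (c : M.Cfg) : Option M.Cfg :=
  (M.trans c.state (readInput w c.inputPos) (c.work c.workPos)).map fun a =>
    { state := a.next
      inputPos := moveInput w.length a.inputMove c.inputPos
      work := Function.update c.work c.workPos a.write
      workPos := moveWork a.workMove c.workPos
      output := c.output ++ a.output.toList }

/-- The configuration after `t` steps on input `w`; once the machine has halted, the configuration
no longer changes. -/
def cfgAt (w : List Bool) (t : ℕ) : M.Cfg :=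
  (fun c => (M.step w c).getD c)^[t] M.init

/-- On input `w`, the machine halts after at most `t` steps. -/
def HaltsBy (w : List Bool) (t : ℕ) : Prop :=
  M.step w (M.cfgAt w t) = none

/-- `M` decides the language `L` within `T n` steps on inputs of length `n`. -/
def DecidesInTime (L : Language Bool) (T : ℕ → ℕ) : Prop :=
  ∀ w : List Bool, M.HaltsBy w (T w.length) ∧
    ((M.cfgAt w (T w.length)).state ∈ M.accept ↔ w ∈ L)

/-- On every input `w`, `M` halts with `f w` on its output tape. -/
def Computes (f : List Bool → List Bool) : Prop :=
  ∀ w : List Bool, ∃ t : ℕ, M.HaltsBy w t ∧ (M.cfgAt w t).output = f w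

/-- `M` visits at most `s n` work cells on inputs of length `n`. As the work head starts on cell `0`
and moves by single cells, this says that it never leaves the cells `0, …, s n - 1`. Neither the
input tape nor the output tape counts. -/
def UsesSpace (s : ℕ → ℕ) : Prop :=
  ∀ (w : List Bool) (t : ℕ), (M.cfgAt w t).workPos < s w.length

/-- `M` runs in logarithmic space: it visits `O(log n)` work cells. -/
def IsLogSpace : Prop :=
  ∃ c : ℕ, M.UsesSpace fun n => c * (Nat.log 2 n + 1)

end DTM

/-- `f` is computable by a log-space deterministic Turing machine. -/
def LogSpaceComputable (f : List Bool → List Bool) : Prop :=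
  ∃ M : DTM, M.IsLogSpace ∧ M.Computes f

/-- The class P: languages decided by a deterministic Turing machine in polynomial time. -/
def ClassP : Set (Language Bool) :=
  {L | ∃ (M : DTM) (p : Polynomial ℕ), M.DecidesInTime L fun n => p.eval n}

/-- Log-space many-one reducibility. -/
def LogSpaceReducible (A B : Language Bool) : Prop :=
  ∃ f : List Bool → List Bool, LogSpaceComputable f ∧ ∀ w : List Bool, w ∈ A ↔ f w ∈ B

/-- P-completeness (under log-space many-one reductions). -/
def PComplete (L : Language Bool) : Prop :=
  L ∈ ClassP ∧ ∀ A ∈ ClassP, LogSpaceReducible A L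

/-- The flattening of a single bit: `0 ↦ 10`, `1 ↦ 01`. -/
def flattenBit : Bool → List Bool
  | false => [true, false]
  | true => [false, true]

/-- The flattened input: every bit is replaced by its flattening. -/
def flatten (w : List Bool) : List Bool :=
  w.flatMap flattenBit

/-- The flattened problem: its yes-instances are the flattenings of the yes-instances of `L`. -/
def flattenProblem (L : Language Bool) : Language Bool :=
  {v | ∃ w ∈ L, flatten w = v}

end LogSpaceFlattening

/-!
A log-space machine `M` computing `f` emits at most one bit per step. Replacing every step of `M` by
two steps, the first doing what `M` does but emitting the complement `!b` of the bit `b` that `M`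
emits, the second emitting `b` itself, gives a machine for `flatten ∘ f` on the same work cells
(`LogSpaceComputable.flatten_comp`), because `flattenBit b = [!b, b]`. Applied to the identity, this
shows that `flatten` is log-space computable; applied to a reduction `f` from `A` to `L`, it gives a
reduction from `A` to `flattenProblem L`, as `flatten` is injective. No general theorem on the
composition of log-space functions is needed.

Membership in P (`flattenProblem_mem_classP`) comes from a machine which first scans its input to
check that it is a flattening, then rewinds and simulates a decider `M` of `L`. The simulation is
in place: cell `i` of the input tape of `M` on `w` corresponds to cell `2 * i - 1` of the input tape
on `flatten w`. With truncated subtraction this matches the left end marker with the left end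
marker, the right one with the right one, and each bit with the first bit of its flattening. A move
of `M` therefore costs two moves.

In both cases the two-step simulation is a semiconjugacy between the step maps of the two machines.
-/

namespace LogSpaceFlattening

/-! ### Flattening of words -/

@[simp]
theorem flatten_nil : flatten [] = [] := rfl

@[simp]
theorem flatten_cons (b : Bool) (w : List Bool) : flatten (b :: w) = (!b) :: b :: flatten w := by
  cases b <;> rfl

theorem flatten_append (v w : List Bool) : flatten (v ++ w) = flatten v ++ flatten w :=
  List.flatMap_append

@[simp]
theorem length_flatten (w : List Bool) : (flatten w).length = 2 * w.length := by
  induction w with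
  | nil => rfl
  | cons b w ih => simp [ih]; omega

theorem flatten_injective : Function.Injective flatten := by
  intro v
  induction v with
  | nil => intro w h; cases w <;> simp_all
  | cons b v ih =>
    intro w h
    cases w with
    | nil => simp at h
    | cons c w =>
      simp only [flatten_cons, List.cons.injEq] at h
      rw [h.2.1, ih h.2.2]

theorem flatten_mem_flattenProblem {L : Language Bool} {w : List Bool} :
    flatten w ∈ flattenProblem L ↔ w ∈ L :=
  ⟨fun ⟨_, hv, h⟩ => flatten_injective h ▸ hv, fun h => ⟨w, h, rfl⟩⟩

theorem getElem?_flatten_two_mul (w : List Bool) (i : ℕ) :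
    (flatten w)[2 * i]? = w[i]?.map (!·) := by
  induction w generalizing i with
  | nil => simp
  | cons b w ih =>
    cases i with
    | zero => simp
    | succ i => simp [Nat.mul_succ, ih]

namespace DTM

/-! ### Runs of machines -/

/-- The step map of `M` on input `w`, made total by fixing the halting configurations. -/
def next (M : DTM) (w : List Bool) (c : M.Cfg) : M.Cfg :=
  (M.step w c).getD c

section

variable {M : DTM} {w : List Bool}

theorem cfgAt_eq (t : ℕ) : M.cfgAt w t = (M.next w)^[t] M.init := rfl

theorem cfgAt_succ (t : ℕ) : M.cfgAt w (t + 1) = M.next w (M.cfgAt w t) :=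
  Function.iterate_succ_apply' ..

theorem next_of_step_eq_none {c : M.Cfg} (h : M.step w c = none) : M.next w c = c := by
  simp [next, h]

theorem next_of_trans_eq_some {c : M.Cfg} {a : Action M.State M.Sym}
    (h : M.trans c.state (readInput w c.inputPos) (c.work c.workPos) = some a) :
    M.next w c =
      { state := a.next
        inputPos := moveInput w.length a.inputMove c.inputPos
        work := Function.update c.work c.workPos a.write
        workPos := moveWork a.workMove c.workPos
        output := c.output ++ a.output.toList } := by
  simp [next, step, h]

theorem step_eq_none_iff {c : M.Cfg} :
    M.step w c = none ↔
      M.trans c.state (readInput w c.inputPos) (c.work c.workPos) = none := by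
  simp [step]

theorem HaltsBy.cfgAt_eq {t u : ℕ} (h : M.HaltsBy w t) (htu : t ≤ u) :
    M.cfgAt w u = M.cfgAt w t := by
  induction u, htu using Nat.le_induction with
  | base => rfl
  | succ u _ ih => rw [cfgAt_succ, ih, next_of_step_eq_none h]

theorem HaltsBy.mono {t u : ℕ} (h : M.HaltsBy w t) (htu : t ≤ u) : M.HaltsBy w u := by
  rw [HaltsBy, h.cfgAt_eq htu]; exact h

end

theorem readInput_eq_leftEnd {w : List Bool} {i : ℕ} : readInput w i = .leftEnd ↔ i = 0 := by
  cases i with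
  | zero => simp [readInput]
  | succ i => rw [readInput]; split <;> simp

theorem readInput_succ_of_getElem? {w : List Bool} {i : ℕ} {b : Bool} (h : w[i]? = some b) :
    readInput w (i + 1) = .bit b := by
  simp [readInput, h]

theorem readInput_length_succ (w : List Bool) : readInput w (w.length + 1) = .rightEnd := by
  simp [readInput]

/-! ### Flattening the output of a machine -/

/-- The machine that outputs the flattening of what `M` outputs, with two steps for each step
of `M`. A state `.inl q` is the state `q` of `M`; in a state `.inr (q, o)` the machine still has to
emit `o` before it proceeds to `q`. -/
def flattenOutput (M : DTM) : DTM where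
  State := M.State ⊕ M.State × Option Bool
  Sym := M.Sym
  finite_state := have := M.finite_state; inferInstance
  finite_sym := M.finite_sym
  start := .inl M.start
  blank := M.blank
  accept := ∅
  trans
    | .inl q, s, x => (M.trans q s x).map fun a =>
        { a with next := .inr (a.next, a.output), output := a.output.map (!·) }
    | .inr (q, o), _, x =>
        some { next := .inl q, inputMove := .stay, write := x, workMove := .stay, output := o }

/-- The configuration of `M.flattenOutput` that represents the configuration `c` of `M`. -/
def flattenOutputCfg (M : DTM) (c : M.Cfg) : M.flattenOutput.Cfg where
  state := .inl c.state
  inputPos := c.inputPos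
  work := c.work
  workPos := c.workPos
  output := flatten c.output

section

variable (M : DTM) (w : List Bool) (c : M.Cfg)

theorem step_flattenOutputCfg_eq_none_iff :
    M.flattenOutput.step w (M.flattenOutputCfg c) = none ↔ M.step w c = none := by
  rw [step_eq_none_iff, step_eq_none_iff]
  exact Option.map_eq_none_iff

/-- The work head moves in the first of the two steps. -/
theorem workPos_next_flattenOutputCfg :
    (M.flattenOutput.next w (M.flattenOutputCfg c)).workPos = (M.next w c).workPos := by
  cases h : M.trans c.state (readInput w c.inputPos) (c.work c.workPos) with
  | none =>
    rw [next_of_step_eq_none (step_eq_none_iff.2 h), next_of_step_eq_none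
      ((step_flattenOutputCfg_eq_none_iff M w c).2 (step_eq_none_iff.2 h))]
    rfl
  | some a =>
    have h' : M.flattenOutput.trans (.inl c.state) (readInput w c.inputPos) (c.work c.workPos) =
        some { a with next := .inr (a.next, a.output), output := a.output.map (!·) } :=
      congrArg (Option.map _) h
    rw [next_of_trans_eq_some h, next_of_trans_eq_some (c := M.flattenOutputCfg c) h']
    rfl

theorem next_next_flattenOutputCfg :
    M.flattenOutput.next w (M.flattenOutput.next w (M.flattenOutputCfg c)) =
      M.flattenOutputCfg (M.next w c) := by
  cases h : M.trans c.state (readInput w c.inputPos) (c.work c.workPos) with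
  | none =>
    have h₀ := step_eq_none_iff.2 h
    have h₁ := next_of_step_eq_none ((step_flattenOutputCfg_eq_none_iff M w c).2 h₀)
    rw [next_of_step_eq_none h₀, h₁, h₁]
  | some a =>
    have h' : M.flattenOutput.trans (.inl c.state) (readInput w c.inputPos) (c.work c.workPos) =
        some { a with next := .inr (a.next, a.output), output := a.output.map (!·) } :=
      congrArg (Option.map _) h
    rw [next_of_trans_eq_some h, next_of_trans_eq_some (c := M.flattenOutputCfg c) h']
    rw [next_of_trans_eq_some rfl]
    simp only [flattenOutputCfg, moveInput, moveWork, Function.update_eq_self, flatten_append,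
      List.append_assoc]
    -- `rfl` identifies the symbol type of `M.flattenOutput` with that of `M`.
    cases a.output <;> simp <;> rfl

theorem cfgAt_flattenOutput (t : ℕ) :
    M.flattenOutput.cfgAt w (2 * t) = M.flattenOutputCfg (M.cfgAt w t) := by
  have h : Function.Semiconj M.flattenOutputCfg (M.next w) (M.flattenOutput.next w)^[2] :=
    fun c => (next_next_flattenOutputCfg M w c).symm
  rw [cfgAt_eq, cfgAt_eq, Function.iterate_mul]
  exact ((h.iterate_right t).eq M.init).symm

end

theorem Computes.flattenOutput {M : DTM} {f : List Bool → List Bool} (h : M.Computes f) :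
    M.flattenOutput.Computes (flatten ∘ f) := by
  intro w
  obtain ⟨t, ht, hf⟩ := h w
  refine ⟨2 * t, ?_, ?_⟩
  · rw [HaltsBy, cfgAt_flattenOutput, step_flattenOutputCfg_eq_none_iff]
    exact ht
  · rw [cfgAt_flattenOutput]
    exact congrArg flatten hf

theorem UsesSpace.flattenOutput {M : DTM} {s : ℕ → ℕ} (h : M.UsesSpace s) :
    M.flattenOutput.UsesSpace s := by
  intro w t
  obtain ⟨k, rfl | rfl⟩ := t.even_or_odd'
  · rw [cfgAt_flattenOutput]
    exact h w k
  · rw [cfgAt_succ, cfgAt_flattenOutput, workPos_next_flattenOutputCfg, ← cfgAt_succ]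
    exact h w (k + 1)

/-! ### A machine for the identity function -/

/-- The machine that copies its input to its output. -/
def copy : DTM where
  State := Unit
  Sym := Unit
  finite_state := inferInstance
  finite_sym := inferInstance
  start := ()
  blank := ()
  accept := ∅
  trans
    | _, .leftEnd, _ => some ⟨(), .right, (), .stay, none⟩
    | _, .bit b, _ => some ⟨(), .right, (), .stay, some b⟩
    | _, .rightEnd, _ => none

theorem copy_usesSpace {s : ℕ → ℕ} (hs : ∀ n, 0 < s n) : copy.UsesSpace s := by
  intro w t
  suffices h : (copy.cfgAt w t).workPos = 0 from h ▸ hs _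
  induction t with
  | zero => rfl
  | succ t ih =>
    rw [cfgAt_succ]
    generalize copy.cfgAt w t = c at ih ⊢
    cases h : copy.trans c.state (readInput w c.inputPos) (c.work c.workPos) with
    | none => rwa [next_of_step_eq_none (step_eq_none_iff.2 h)]
    | some a =>
      rw [next_of_trans_eq_some h]
      cases hr : readInput w c.inputPos <;> rw [hr] at h <;> cases h <;> exact ih

theorem cfgAt_copy (w : List Bool) {t : ℕ} (ht : t ≤ w.length) :
    copy.cfgAt w (t + 1) = ⟨(), t + 1, fun _ => (), 0, w.take t⟩ := by
  induction t with
  | zero =>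
    rw [cfgAt_succ, next_of_trans_eq_some rfl]
    simp [cfgAt_eq, init, moveInput, moveWork]
    rfl
  | succ t ih =>
    have hw : w[t]? = some w[t] := List.getElem?_eq_getElem ht
    have h : copy.trans () (readInput w (t + 1)) () = some ⟨(), .right, (), .stay, some w[t]⟩ := by
      rw [readInput_succ_of_getElem? hw]; rfl
    rw [cfgAt_succ, ih (by omega), next_of_trans_eq_some h]
    simp [moveInput, moveWork, ht]
    rfl

theorem copy_computes : copy.Computes id := by
  intro w
  refine ⟨w.length + 1, ?_, ?_⟩
  · rw [HaltsBy, cfgAt_copy w le_rfl, step_eq_none_iff]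
    simp only [readInput_length_succ]
    rfl
  · simp [cfgAt_copy w le_rfl]

/-! ### Deciding the flattened problem -/

instance : Finite Move :=
  Finite.of_surjective (fun i : Fin 3 => ![Move.left, .stay, .right] i) fun
    | .left => ⟨0, rfl⟩
    | .stay => ⟨1, rfl⟩
    | .right => ⟨2, rfl⟩

/-- The states in which a machine checks that its input is a flattening: `first` and `second b`
before the first and the second bit of a pair, where `b` is the first bit of the pair, and `rewind`
on the way back to the left end. -/
inductive ScanState : Type
  | first
  | second (b : Bool)
  | rewind

instance : Finite ScanState :=
  Finite.of_surjective (fun x : Option (Option Bool) => match x with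
    | none => ScanState.first
    | some none => .rewind
    | some (some b) => .second b) fun
    | .first => ⟨none, rfl⟩
    | .second b => ⟨some (some b), rfl⟩
    | .rewind => ⟨some none, rfl⟩

/-- The input symbol of `w` that corresponds to a symbol of `flatten w`, where the symbol of
`flatten w` is an end marker or the first bit of a pair. -/
def decodeSymbol : InputSymbol → InputSymbol
  | .bit b => .bit !b
  | s => s

/-- The second of the two moves that simulate a move of the input head, given the symbol under the
head before the first one. The left end marker is a single cell, not a pair: one move to the right
is enough to leave it. -/
def secondMove : InputSymbol → Move → Move
  | .leftEnd, .right => .stay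
  | _, m => m

/-- The machine that accepts the flattenings of the words that `M` accepts. A state `.inl s` is a
state of the scan; after it, `.inr (.inl q)` is the state `q` of `M`, and in `.inr (.inr (q, m))`
the machine still has to make the input move `m` before it proceeds to `q`. The scan rejects by
halting in a state `.inl s`. -/
def decodeInput (M : DTM) : DTM where
  State := ScanState ⊕ M.State ⊕ M.State × Move
  Sym := M.Sym
  finite_state := have := M.finite_state; inferInstance
  finite_sym := M.finite_sym
  start := .inl .first
  blank := M.blank
  accept := {q | ∃ p ∈ M.accept, q = .inr (.inl p)}
  trans
    | .inl .first, .leftEnd, x => some ⟨.inl .first, .right, x, .stay, none⟩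
    | .inl .first, .bit b, x => some ⟨.inl (.second b), .right, x, .stay, none⟩
    | .inl .first, .rightEnd, x => some ⟨.inl .rewind, .stay, x, .stay, none⟩
    | .inl (.second b), .bit b', x =>
        if b = !b' then some ⟨.inl .first, .right, x, .stay, none⟩ else none
    | .inl (.second _), _, _ => none
    | .inl .rewind, .leftEnd, x => some ⟨.inr (.inl M.start), .stay, x, .stay, none⟩
    | .inl .rewind, _, x => some ⟨.inl .rewind, .left, x, .stay, none⟩
    | .inr (.inl q), s, x => (M.trans q (decodeSymbol s) x).map fun a =>
        { a with next := .inr (.inr (a.next, secondMove s a.inputMove)) }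
    | .inr (.inr (q, m)), _, x => some ⟨.inr (.inl q), m, x, .stay, none⟩

section Simulation

theorem decodeSymbol_readInput_flatten (w : List Bool) (i : ℕ) :
    decodeSymbol (readInput (flatten w) (2 * i - 1)) = readInput w i := by
  cases i with
  | zero => rfl
  | succ i =>
    rw [show 2 * (i + 1) - 1 = 2 * i + 1 by omega, readInput, readInput, getElem?_flatten_two_mul]
    cases w[i]? <;> simp [decodeSymbol]

theorem moveInput_flatten (w : List Bool) (m : Move) (i : ℕ) :
    moveInput (flatten w).length (secondMove (readInput (flatten w) (2 * i - 1)) m)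
      (moveInput (flatten w).length m (2 * i - 1)) = 2 * moveInput w.length m i - 1 := by
  rw [length_flatten]
  cases i with
  | zero => cases m <;> simp [readInput, secondMove, moveInput]
  | succ i =>
    have h : secondMove (readInput (flatten w) (2 * (i + 1) - 1)) m = m := by
      have h' : readInput (flatten w) (2 * (i + 1) - 1) ≠ .leftEnd := by
        rw [Ne, readInput_eq_leftEnd]; omega
      revert h'
      cases readInput (flatten w) (2 * (i + 1) - 1) <;> simp [secondMove]
    rw [h]
    cases m <;> simp only [moveInput] <;> omega

variable (M : DTM) (w : List Bool) (c : M.Cfg)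

/-- The configuration of `M.decodeInput` on input `flatten w` that represents the configuration `c`
of `M` on input `w`. -/
def decodeInputCfg (c : M.Cfg) : M.decodeInput.Cfg where
  state := .inr (.inl c.state)
  inputPos := 2 * c.inputPos - 1
  work := c.work
  workPos := c.workPos
  output := c.output

theorem decodeInput_trans_inr_inl (q : M.State) (s : InputSymbol) (x : M.Sym) :
    M.decodeInput.trans (.inr (.inl q)) s x = (M.trans q (decodeSymbol s) x).map fun a =>
      { a with next := .inr (.inr (a.next, secondMove s a.inputMove)) } := by
  cases s <;> rfl

theorem step_decodeInputCfg_eq_none_iff :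
    M.decodeInput.step (flatten w) (M.decodeInputCfg c) = none ↔ M.step w c = none := by
  rw [step_eq_none_iff, step_eq_none_iff]
  simp only [decodeInputCfg]
  rw [decodeInput_trans_inr_inl, Option.map_eq_none_iff, decodeSymbol_readInput_flatten]

theorem next_next_decodeInputCfg :
    M.decodeInput.next (flatten w) (M.decodeInput.next (flatten w) (M.decodeInputCfg c)) =
      M.decodeInputCfg (M.next w c) := by
  cases h : M.trans c.state (readInput w c.inputPos) (c.work c.workPos) with
  | none =>
    have h₀ := step_eq_none_iff.2 h
    have h₁ := next_of_step_eq_none ((step_decodeInputCfg_eq_none_iff M w c).2 h₀)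
    rw [next_of_step_eq_none h₀, h₁, h₁]
  | some a =>
    have h' := decodeInput_trans_inr_inl M c.state
      (readInput (flatten w) (2 * c.inputPos - 1)) (c.work c.workPos)
    rw [decodeSymbol_readInput_flatten, h, Option.map_some] at h'
    rw [next_of_trans_eq_some h, next_of_trans_eq_some (c := M.decodeInputCfg c) h']
    rw [next_of_trans_eq_some rfl]
    simp only [decodeInputCfg, moveInput_flatten]
    simp [moveWork]
    -- `rfl` identifies the symbol type of `M.decodeInput` with that of `M`.
    rfl

theorem iterate_next_decodeInputCfg (t : ℕ) :
    (M.decodeInput.next (flatten w))^[2 * t] (M.decodeInputCfg M.init) =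
      M.decodeInputCfg (M.cfgAt w t) := by
  have h : Function.Semiconj M.decodeInputCfg (M.next w) (M.decodeInput.next (flatten w))^[2] :=
    fun c => (next_next_decodeInputCfg M w c).symm
  rw [cfgAt_eq, Function.iterate_mul]
  exact ((h.iterate_right t).eq M.init).symm

end Simulation

section Scan

variable (M : DTM)

/-- The configuration with blank work tape and empty output, in scan state `s` with the input head
on cell `i`. -/
def scanCfg (s : ScanState) (i : ℕ) : M.decodeInput.Cfg :=
  ⟨.inl s, i, fun _ => M.blank, 0, []⟩

theorem next_scanCfg {v : List Bool} {s s' : ScanState} {i : ℕ} {m : Move}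
    (h : M.decodeInput.trans (.inl s) (readInput v i) M.blank =
      some ⟨.inl s', m, M.blank, .stay, none⟩) :
    M.decodeInput.next v (scanCfg M s i) = scanCfg M s' (moveInput v.length m i) := by
  rw [next_of_trans_eq_some (c := scanCfg M s i) h]
  exact congrArg (fun f => (⟨.inl s', _, f, 0, []⟩ : M.decodeInput.Cfg))
    (Function.update_eq_self 0 fun _ => M.blank)

theorem step_scanCfg_eq_none {v : List Bool} {s : ScanState} {i : ℕ}
    (h : M.decodeInput.trans (.inl s) (readInput v i) M.blank = none) :
    M.decodeInput.step v (scanCfg M s i) = none :=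
  step_eq_none_iff.2 h

theorem iterate_next_rewind (v : List Bool) (i : ℕ) :
    (M.decodeInput.next v)^[i + 1] (scanCfg M .rewind i) = M.decodeInputCfg M.init := by
  induction i with
  | zero =>
    rw [Function.iterate_one, next_of_trans_eq_some rfl]
    exact congrArg (fun f => (⟨.inr (.inl M.start), 0, f, 0, []⟩ : M.decodeInput.Cfg))
      (Function.update_eq_self 0 fun _ => M.blank)
  | succ i ih =>
    rw [Function.iterate_succ_apply, next_scanCfg M (s' := .rewind) (m := .left)]
    · exact ih
    · rw [readInput]
      split <;> rfl

/-- The scan, started in front of the suffix `u` of its input `v ++ u`, either finds that `u` is a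
flattening or halts in a scan state. -/
theorem scan (v u : List Bool) :
    ∃ t ≤ u.length + 1,
      (u ∈ Set.range flatten ∧ (M.decodeInput.next (v ++ u))^[t] (scanCfg M .first (v.length + 1)) =
        scanCfg M .rewind ((v ++ u).length + 1)) ∨
      (u ∉ Set.range flatten ∧ ∃ s i,
        (M.decodeInput.next (v ++ u))^[t] (scanCfg M .first (v.length + 1)) = scanCfg M s i ∧
        M.decodeInput.step (v ++ u) (scanCfg M s i) = none) := by
  -- Reading the first bit of a pair.
  have first : ∀ (v u : List Bool) (a : Bool),
      M.decodeInput.next (v ++ a :: u) (scanCfg M .first (v.length + 1)) =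
        scanCfg M (.second a) (v.length + 2) := by
    intro v u a
    rw [next_scanCfg M (s' := .second a) (m := .right)]
    · simp only [moveInput, List.length_append, List.length_cons]
      congr 1
      omega
    · rw [readInput_succ_of_getElem? (b := a) (by simp)]
      rfl
  match u with
  | [] =>
    refine ⟨1, le_rfl, .inl ⟨⟨[], rfl⟩, ?_⟩⟩
    rw [Function.iterate_one, List.append_nil, next_scanCfg M (s' := .rewind) (m := .stay)]
    · rfl
    · rw [readInput_length_succ]
      rfl
  | [a] =>
    refine ⟨1, by simp, .inr ⟨?_, .second a, v.length + 2, first v [] a, ?_⟩⟩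
    · rintro ⟨w, hw⟩
      have := congrArg List.length hw
      simp at this
    · have hr := readInput_length_succ (v ++ [a])
      rw [List.length_append] at hr
      exact step_scanCfg_eq_none M (hr ▸ rfl)
  | a :: b :: u =>
    have hb : readInput (v ++ a :: b :: u) (v.length + 2) = .bit b :=
      readInput_succ_of_getElem? (by simp)
    by_cases hab : a = !b
    · have second : M.decodeInput.next (v ++ a :: b :: u) (scanCfg M (.second a) (v.length + 2)) =
          scanCfg M .first (v.length + 3) := by
        rw [next_scanCfg M (s' := .first) (m := .right)]
        · simp only [moveInput, List.length_append, List.length_cons]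
          congr 1
          omega
        · rw [hb]
          exact if_pos hab
      have hu : a :: b :: u ∈ Set.range flatten ↔ u ∈ Set.range flatten := by
        constructor
        · rintro ⟨w, hw⟩
          cases w with
          | nil => simp at hw
          | cons c w => exact ⟨w, by simp_all⟩
        · rintro ⟨w, rfl⟩
          exact ⟨b :: w, by simp [hab]⟩
      obtain ⟨t, ht, h⟩ := scan (v ++ [a, b]) u
      refine ⟨t + 2, by simp; omega, ?_⟩
      rw [hu, Function.iterate_add_apply, show (M.decodeInput.next (v ++ a :: b :: u))^[2]
        (scanCfg M .first (v.length + 1)) = scanCfg M .first (v.length + 3) from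
        (congrArg _ (first v (b :: u) a)).trans second]
      simpa only [List.append_assoc, List.cons_append, List.nil_append, List.length_append,
        List.length_cons, List.length_nil] using h
    · refine ⟨1, by simp, .inr ⟨?_, .second a, v.length + 2, first v (b :: u) a, ?_⟩⟩
      · rintro ⟨w, hw⟩
        cases w with
        | nil => simp at hw
        | cons c w =>
          simp only [flatten_cons, List.cons.injEq] at hw
          exact hab (by rw [← hw.1, hw.2.1])
      · exact step_scanCfg_eq_none M (hb ▸ if_neg hab)
termination_by u.length

theorem cfgAt_decodeInput_one (v : List Bool) : M.decodeInput.cfgAt v 1 = scanCfg M .first 1 := by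
  rw [cfgAt_eq, show M.decodeInput.init = scanCfg M .first 0 from rfl, Function.iterate_one,
    next_scanCfg M (s' := .first) (m := .right) rfl]
  simp [moveInput]

theorem decodeInput_scan_flatten (w : List Bool) :
    ∃ t ≤ 2 * (flatten w).length + 4,
      M.decodeInput.cfgAt (flatten w) t = M.decodeInputCfg M.init := by
  obtain ⟨t, ht, ⟨-, h⟩ | ⟨h, -⟩⟩ := scan M [] (flatten w)
  · refine ⟨((flatten w).length + 1 + 1) + (t + 1), by omega, ?_⟩
    rw [cfgAt_eq, Function.iterate_add_apply, Function.iterate_add_apply _ t 1, ← cfgAt_eq,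
      cfgAt_decodeInput_one]
    exact (congrArg _ h).trans (iterate_next_rewind M _ _)
  · exact absurd ⟨w, rfl⟩ h

theorem decodeInput_scan_of_notMem {v : List Bool} (hv : v ∉ Set.range flatten) :
    ∃ t ≤ v.length + 2, M.decodeInput.HaltsBy v t ∧
      (M.decodeInput.cfgAt v t).state ∉ M.decodeInput.accept := by
  obtain ⟨t, ht, ⟨h, -⟩ | ⟨-, s, i, h, hs⟩⟩ := scan M [] v
  · exact absurd h hv
  · have h' : M.decodeInput.cfgAt v (t + 1) = scanCfg M s i := by
      rw [cfgAt_eq, Function.iterate_add_apply, ← cfgAt_eq, cfgAt_decodeInput_one]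
      exact h
    refine ⟨t + 1, by omega, ?_, ?_⟩
    · rw [HaltsBy, h']
      exact hs
    · rw [h']
      rintro ⟨p, -, hp⟩
      cases hp

end Scan

theorem DecidesInTime.decodeInput {M : DTM} {L : Language Bool} {T : ℕ → ℕ} (hT : Monotone T)
    (h : M.DecidesInTime L T) :
    M.decodeInput.DecidesInTime (flattenProblem L) fun n => 2 * T n + (2 * n + 4) := by
  intro v
  by_cases hv : v ∈ Set.range flatten
  · obtain ⟨w, rfl⟩ := hv
    obtain ⟨t, ht, hscan⟩ := decodeInput_scan_flatten M w
    have hrun : M.decodeInput.cfgAt (flatten w) (2 * T w.length + t) =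
        M.decodeInputCfg (M.cfgAt w (T w.length)) := by
      rw [cfgAt_eq, Function.iterate_add_apply, ← cfgAt_eq, hscan, iterate_next_decodeInputCfg]
    have hhalt : M.decodeInput.HaltsBy (flatten w) (2 * T w.length + t) := by
      rw [HaltsBy, hrun, step_decodeInputCfg_eq_none_iff]
      exact (h w).1
    have hle : 2 * T w.length + t ≤ 2 * T (flatten w).length + (2 * (flatten w).length + 4) := by
      have : T w.length ≤ T (flatten w).length := hT (by rw [length_flatten]; omega)
      omega
    refine ⟨hhalt.mono hle, ?_⟩
    rw [hhalt.cfgAt_eq hle, hrun, flatten_mem_flattenProblem, ← (h w).2]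
    constructor
    · rintro ⟨p, hp, hq⟩
      cases hq
      exact hp
    · exact fun hp => ⟨_, hp, rfl⟩
  · obtain ⟨t, ht, hhalt, hrej⟩ := decodeInput_scan_of_notMem M hv
    have hle : t ≤ 2 * T v.length + (2 * v.length + 4) := by omega
    refine ⟨hhalt.mono hle, ?_⟩
    rw [hhalt.cfgAt_eq hle]
    exact iff_of_false hrej fun ⟨w, _, hw⟩ => hv ⟨w, hw⟩

end DTM

/-! ### Log-space computability and P-completeness -/

theorem LogSpaceComputable.flatten_comp {f : List Bool → List Bool} (hf : LogSpaceComputable f) :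
    LogSpaceComputable (flatten ∘ f) :=
  let ⟨M, ⟨c, hc⟩, hM⟩ := hf
  ⟨M.flattenOutput, ⟨c, hc.flattenOutput⟩, hM.flattenOutput⟩

theorem logSpaceComputable_id : LogSpaceComputable id :=
  ⟨DTM.copy, ⟨1, DTM.copy_usesSpace fun _ => by omega⟩, DTM.copy_computes⟩

theorem LogSpaceReducible.flattenProblem {A L : Language Bool} (h : LogSpaceReducible A L) :
    LogSpaceReducible A (flattenProblem L) :=
  let ⟨f, hf, hAL⟩ := h
  ⟨flatten ∘ f, hf.flatten_comp, fun w => (hAL w).trans flatten_mem_flattenProblem.symm⟩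

theorem flattenProblem_mem_classP {L : Language Bool} (hL : L ∈ ClassP) :
    flattenProblem L ∈ ClassP := by
  obtain ⟨M, p, h⟩ := hL
  have hp : Monotone fun n => p.eval n := fun a b hab => by
    simp only [Polynomial.eval_eq_sum_range]
    gcongr
  refine ⟨M.decodeInput, 2 * p + (2 * Polynomial.X + 4), ?_⟩
  simpa using h.decodeInput hp

end LogSpaceFlattening

theorem mainTheorem2 :
    LogSpaceFlattening.LogSpaceComputable LogSpaceFlattening.flatten ∧
      ∀ L : Language Bool, LogSpaceFlattening.PComplete L →
        LogSpaceFlattening.PComplete (LogSpaceFlattening.flattenProblem L) :=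
  ⟨LogSpaceFlattening.logSpaceComputable_id.flatten_comp, fun _ hL =>
    ⟨LogSpaceFlattening.flattenProblem_mem_classP hL.1, fun A hA => (hL.2 A hA).flattenProblem⟩⟩
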